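/- Let $1<p<\infty$ and let $(V,\mu)$ be an infinite, connected, locally finite weighted graph: $\mu_{xy}=\mu_{yx}\ge 0$, and $\mu_{xy}>0$ if and only if $x\sim y$. Put $\mu(x)=\sum_{y\sim x}\mu_{xy}$ and $$\Delta_p u(x)=\frac1{\mu(x)}\sum_{y\sim x}\mu_{xy}|u(y)-u(x)|^{p-2}(u(y)-u(x)),\qquad D_p(f;S)=\frac12\sum_{x,y\in S}\mu_{xy}|f(x)-f(y)|^p\in[0,\infty]$$ for $S\subset V$. For $A,B\subset S$ let $C_p(A,B;S)$ be the infimum of $D_p(f;S)$ over all $f:S\to\mathbb R$ with $f=1$ on $A$ and $f=0$ on $B$ ($\inf\emptyset=\infty$), and let $C_p(K,\infty;S)=\lim_n C_p(K,S\setminus B_n;S)$ for an exhaustion $(B_n)$ of $V$ by finite sets. - A set $S\subset V$ is *$p$-parabolic* if $C_p(K,\infty;S)=0$ for every finite $K\subset S$. - For $K\subset U\subset V$, where $K$ may be infinite, $\operatorname{cap}_p(K,U)=C_p(K,V\setminus U;V)$. - A set $\Omega\subset V$ is *$D_p$-massive* if there is $u:V\to\mathbb R$ with $0<u<1$ and $\Delta_pu=0$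 on $\Omega$, $u=1$ on $V\setminus\Omega$, and $D_p(u;V)<\infty$. Let $\Omega\subset V$ be nonempty with $\Omega\neq V$, and consider the condition $(*)$ there is a subset $\Omega_1\subset\Omega$ that is not $p$-parabolic and satisfies $\operatorname{cap}_p(\Omega_1,\Omega)<\infty$. **Theorem.** 1. If $\Omega$ is connected (as an induced subgraph), then $\Omega$ is $D_p$-massive if and only if $(*)$ holds. 2. If $\Omega$ is $D_p$-massive, connected or not, then $(*)$ holds. 3. For every such $\Omega$, connected or not, $(*)$ holds if and only if $\Omega$ contains a nonempty connected $D_p$-massive set. -/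

import Mathlib

open scoped ENNReal

/-- A graph on the vertex set `V` with symmetric edge weights `μ x y ≥ 0` such that
`μ x y > 0` exactly when `x` and `y` are adjacent. -/
structure WeightedGraph (V : Type*) where
  /-- the underlying graph -/
  graph : SimpleGraph V
  /-- the edge weight `μ` -/
  weight : V → V → ℝ
  weight_nonneg : ∀ x y, 0 ≤ weight x y
  weight_symm : ∀ x y, weight x y = weight y x
  weight_pos_iff : ∀ x y, 0 < weight x y ↔ graph.Adj x y

namespace WeightedGraph

variable {V : Type*} (W : WeightedGraph V)

/-- The canonical vertex measure `μ(x) = ∑_{y ∼ x} μ x y`. -/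
noncomputable def vertexWeight [W.graph.LocallyFinite] (x : V) : ℝ :=
  ∑ y ∈ W.graph.neighborFinset x, W.weight x y

/-- The graph `p`-Laplacian
`Δ_p u (x) = μ(x)⁻¹ ∑_{y ∼ x} μ x y |u y - u x|^(p-2) (u y - u x)`. -/
noncomputable def pLaplacian [W.graph.LocallyFinite] (p : ℝ) (u : V → ℝ) (x : V) : ℝ :=
  1 / W.vertexWeight x *
    ∑ y ∈ W.graph.neighborFinset x, W.weight x y * (|u y - u x| ^ (p - 2) * (u y - u x))

/-- The `p`-Dirichlet energy `D_p(f; S) = 1/2 ∑_{x, y ∈ S} μ x y |f x - f y|^p` of `f` on the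
vertex set `S`, with values in `[0, ∞]`. Only the values of `f` on `S` matter. -/
noncomputable def pEnergy (p : ℝ) (S : Set V) (f : V → ℝ) : ℝ≥0∞ :=
  1 / 2 * ∑' (x : S) (y : S), ENNReal.ofReal (W.weight x y * |f x - f y| ^ p)

/-- The `p`-effective conductance `C_p(A, B; S)`: the infimum of `D_p(f; S)` over all `f` with
`f = 1` on `A` and `f = 0` on `B`. It is `∞` if no such `f` has finite energy. -/
noncomputable def conductance (p : ℝ) (A B S : Set V) : ℝ≥0∞ :=
  ⨅ (f : V → ℝ) (_ : ∀ x ∈ A, f x = 1) (_ : ∀ x ∈ B, f x = 0), W.pEnergy p S f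

/-- The conductance to infinity `C_p(K, ∞; S)`: the limit of `C_p(K, S \ B; S)` as the finite set
`B` increases to the whole vertex set. As `C_p(K, S \ B; S)` decreases when `B` grows, the limit is
the infimum over all finite `B`. -/
noncomputable def conductanceInfty (p : ℝ) (K S : Set V) : ℝ≥0∞ :=
  ⨅ B : Finset V, W.conductance p K (S \ (B : Set V)) S

/-- `S` is `p`-parabolic: `C_p(K, ∞; S) = 0` for every finite `K ⊆ S`. -/
def IsParabolic (p : ℝ) (S : Set V) : Prop :=
  ∀ K : Set V, K.Finite → K ⊆ S → W.conductanceInfty p K S = 0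

/-- The relative capacity `cap_p(K, U) = C_p(K, Uᶜ; V)` of a possibly infinite set `K ⊆ U`. -/
noncomputable def capacity (p : ℝ) (K U : Set V) : ℝ≥0∞ :=
  W.conductance p K Uᶜ Set.univ

/-- `Ω` is `D_p`-massive: there is `u : V → ℝ` with `0 < u < 1` and `Δ_p u = 0` on `Ω`, `u = 1` off
`Ω`, and finite `p`-Dirichlet energy on the whole graph. -/
def IsDpMassive [W.graph.LocallyFinite] (p : ℝ) (Ω : Set V) : Prop :=
  ∃ u : V → ℝ, (∀ x ∈ Ω, 0 < u x ∧ u x < 1) ∧ (∀ x ∈ Ω, W.pLaplacian p u x = 0) ∧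
    (∀ x ∉ Ω, u x = 1) ∧ W.pEnergy p Set.univ u < ∞

end WeightedGraph

/-!
The function `v = 1 - u` turns massiveness of `Ω` into the existence of a function of finite energy
that vanishes off `Ω`, lies in `(0, 1)` on `Ω` and is `p`-harmonic there.

Given such a `v`, a superlevel set `{v > t}` has finite capacity in `Ω`, as truncating `v / t` shows.
If it were `p`-parabolic, one could cut off `(v - t)₊` by functions `f` of arbitrarily small energy
inside the superlevel set. Testing harmonicity of `v` with `(v - t)₊ |f|`, Young's inequality bounds
the flux through a fixed boundary edge of the superlevel set by the energy of `f` up to a small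
error, so this flux vanishes, which is absurd (`not_isParabolic_superlevel`).

Conversely, non-parabolicity of `Ω₁` is witnessed by a single vertex `o`, and the component `U` of
`o` in `Ω` inherits the hypotheses: no edge joins `U` to the rest of `Ω`, so functions can be cut
off to `U` at no cost. Let `g` be a function of finite energy with `g = 1` on `Ω₁ ∩ U` and `g = 0`
off `U`. Minimising the energy with free values in a finite part of `U` gives functions `v_B`, harmonic
on that part and equal to `g` elsewhere, of energy at most that of `g`. A pointwise limit along an
ultrafilter is harmonic on `U`, has finite energy, and by the strong maximum principle lies strictly
between `0` and `1` on `U` unless it vanishes identically. In the latter case the energy of `v_B`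
tends to `0`, since it equals the pairing of the flux of `v_B` with the gradient of the fixed
function `g` (`eventually_tsum_energyDensity_lt`). But then `g - v_B`, which has finite support and
equals `1 - v_B` on `Ω₁ ∩ U`, shows that `o` has conductance zero to infinity
(`isDpMassive_of_conductanceInfty_ne_zero`). No uniform convexity or weak compactness is needed.
-/

/-! ### The scalar flux `a ↦ |a| ^ (p - 2) * a` -/

/-- The nonlinearity `a ↦ |a| ^ (p - 2) * a` of the `p`-Laplacian; it vanishes at `a = 0` for
every `p`. -/
noncomputable def pFlux (p a : ℝ) : ℝ := |a| ^ (p - 2) * a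

lemma pFlux_neg (p a : ℝ) : pFlux p (-a) = -pFlux p a := by
  simp [pFlux]

lemma pFlux_zero (p : ℝ) : pFlux p 0 = 0 := by
  simp [pFlux]

lemma pFlux_nonneg (p : ℝ) {a : ℝ} (ha : 0 ≤ a) : 0 ≤ pFlux p a := by
  unfold pFlux
  positivity

lemma pFlux_pos (p : ℝ) {a : ℝ} (ha : 0 < a) : 0 < pFlux p a := by
  unfold pFlux
  positivity

lemma abs_pFlux {p : ℝ} (hp : 1 < p) (a : ℝ) : |pFlux p a| = |a| ^ (p - 1) := by
  rcases eq_or_ne a 0 with rfl | ha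
  · rw [pFlux_zero, abs_zero, Real.zero_rpow (by linarith)]
  · have h : 0 < |a| := abs_pos.2 ha
    rw [pFlux, abs_mul, abs_of_nonneg (Real.rpow_nonneg h.le _), ← Real.rpow_add_one h.ne']
    congr 1
    ring

lemma pFlux_mul_self {p : ℝ} (hp : 1 < p) (a : ℝ) : pFlux p a * a = |a| ^ p := by
  rcases eq_or_ne a 0 with rfl | ha
  · rw [mul_zero, abs_zero, Real.zero_rpow (by linarith)]
  · have h : 0 < |a| := abs_pos.2 ha
    rw [pFlux, mul_assoc, ← abs_mul_abs_self, ← mul_assoc, ← Real.rpow_add_one h.ne',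
      ← Real.rpow_add_one h.ne']
    congr 1
    ring

lemma continuous_pFlux {p : ℝ} (hp : 1 < p) : Continuous (pFlux p) := by
  -- For `p < 2` the factor `|a| ^ (p - 2)` is singular at `0`, so split by the sign of `a`.
  have h : pFlux p = fun a => max a 0 ^ (p - 1) - max (-a) 0 ^ (p - 1) := by
    funext a
    have h0 : (0 : ℝ) ^ (p - 1) = 0 := Real.zero_rpow (by linarith)
    rcases le_total 0 a with ha | ha
    · rw [max_eq_left ha, max_eq_right (by linarith), h0, sub_zero,
        ← abs_of_nonneg (pFlux_nonneg p ha), abs_pFlux hp, abs_of_nonneg ha]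
    · rw [max_eq_right ha, max_eq_left (by linarith), h0, zero_sub,
        ← neg_neg (pFlux p a), ← pFlux_neg, ← abs_of_nonneg (pFlux_nonneg p (neg_nonneg.2 ha)),
        abs_pFlux hp, abs_of_nonneg (neg_nonneg.2 ha)]
  rw [h]
  have h1 : 0 ≤ p - 1 := by linarith
  exact ((continuous_id.max continuous_const).rpow_const fun _ => Or.inr h1).sub
    ((continuous_neg.max continuous_const).rpow_const fun _ => Or.inr h1)

/-- Young's inequality with a small constant in front of `|a| ^ p`. -/
lemma exists_abs_pFlux_mul_le {p : ℝ} (hp : 1 < p) {ε : ℝ} (hε : 0 < ε) :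
    ∃ C > 0, ∀ a b : ℝ, |pFlux p a| * |b| ≤ ε * |a| ^ p + C * |b| ^ p := by
  have key : ∀ t : ℝ, 0 ≤ t → t ^ p = t ^ (p - 1) * t := fun t ht => by
    rcases ht.eq_or_lt with rfl | ht
    · rw [mul_zero, Real.zero_rpow (by linarith)]
    · rw [← Real.rpow_add_one ht.ne']
      congr 1
      ring
  refine ⟨ε⁻¹ ^ (p - 1), by positivity, fun a b => ?_⟩
  rw [abs_pFlux hp]
  have ha := abs_nonneg a
  have hb := abs_nonneg b
  have hap := Real.rpow_nonneg ha p
  have hbp := Real.rpow_nonneg hb p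
  -- Compare `|b|` with `ε * |a|`.
  rcases le_total |b| (ε * |a|) with h | h
  · calc |a| ^ (p - 1) * |b| ≤ |a| ^ (p - 1) * (ε * |a|) := by gcongr
      _ = ε * |a| ^ p := by rw [key _ ha]; ring
      _ ≤ _ := le_add_of_nonneg_right (by positivity)
  · have h' : |a| ≤ ε⁻¹ * |b| := by
      rw [inv_mul_eq_div, le_div_iff₀ hε]
      linarith
    have h1 : 0 ≤ p - 1 := by linarith
    calc |a| ^ (p - 1) * |b| ≤ (ε⁻¹ * |b|) ^ (p - 1) * |b| := by gcongr
      _ = ε⁻¹ ^ (p - 1) * |b| ^ p := by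
        rw [Real.mul_rpow (by positivity) hb, key _ hb]; ring
      _ ≤ _ := le_add_of_nonneg_left (by positivity)

namespace WeightedGraph

variable {V : Type*} (W : WeightedGraph V)

/-! ### Energy densities -/

/-- The contribution `μ x y * |f x - f y| ^ p` of the ordered pair `(x, y)` to twice the
`p`-Dirichlet energy of `f`. -/
noncomputable def energyDensity (p : ℝ) (f : V → ℝ) (q : V × V) : ℝ :=
  W.weight q.1 q.2 * |f q.1 - f q.2| ^ p

lemma weight_eq_zero {x y : V} (h : ¬ W.graph.Adj x y) : W.weight x y = 0 :=
  le_antisymm (not_lt.1 fun h' => h ((W.weight_pos_iff x y).1 h')) (W.weight_nonneg x y)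

lemma energyDensity_nonneg (p : ℝ) (f : V → ℝ) (q : V × V) : 0 ≤ W.energyDensity p f q :=
  mul_nonneg (W.weight_nonneg _ _) (Real.rpow_nonneg (abs_nonneg _) _)

lemma pEnergy_eq_tsum_indicator (p : ℝ) (S : Set V) (f : V → ℝ) :
    W.pEnergy p S f =
      1 / 2 * ∑' q : V × V, ENNReal.ofReal ((S ×ˢ S).indicator (W.energyDensity p f) q) := by
  classical
  rw [pEnergy, ENNReal.tsum_prod',
    tsum_subtype S fun x => ∑' y : S, ENNReal.ofReal (W.weight x y * |f x - f y| ^ p)]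
  congr 2
  funext x
  by_cases hx : x ∈ S
  · rw [Set.indicator_of_mem hx,
      tsum_subtype S fun y => ENNReal.ofReal (W.weight x y * |f x - f y| ^ p)]
    congr 1
    funext y
    by_cases hy : y ∈ S <;> simp [Set.indicator, hx, hy, energyDensity]
  · simp [Set.indicator, hx]

lemma pEnergy_univ (p : ℝ) (f : V → ℝ) :
    W.pEnergy p Set.univ f = 1 / 2 * ∑' q : V × V, ENNReal.ofReal (W.energyDensity p f q) := by
  simp [pEnergy_eq_tsum_indicator]

lemma summable_indicator_energyDensity {p : ℝ} {S : Set V} {f : V → ℝ}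
    (h : W.pEnergy p S f < ∞) : Summable ((S ×ˢ S).indicator (W.energyDensity p f)) := by
  rw [pEnergy_eq_tsum_indicator] at h
  have h' : ∑' q : V × V, ENNReal.ofReal ((S ×ˢ S).indicator (W.energyDensity p f) q) ≠ ∞ :=
    fun h' => by simp [h', ENNReal.mul_top] at h
  have h0 : ∀ q, 0 ≤ (S ×ˢ S).indicator (W.energyDensity p f) q :=
    Set.indicator_nonneg fun q _ => W.energyDensity_nonneg p f q
  simpa [ENNReal.toReal_ofReal, h0] using ENNReal.summable_toReal h'

lemma summable_energyDensity {p : ℝ} {f : V → ℝ} (h : W.pEnergy p Set.univ f < ∞) :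
    Summable (W.energyDensity p f) := by
  simpa using W.summable_indicator_energyDensity h

lemma pEnergy_eq_ofReal {p : ℝ} {S : Set V} {f : V → ℝ}
    (h : Summable ((S ×ˢ S).indicator (W.energyDensity p f))) :
    W.pEnergy p S f =
      ENNReal.ofReal ((∑' q, (S ×ˢ S).indicator (W.energyDensity p f) q) / 2) := by
  have h0 : ∀ q, 0 ≤ (S ×ˢ S).indicator (W.energyDensity p f) q :=
    Set.indicator_nonneg fun q _ => W.energyDensity_nonneg p f q
  rw [pEnergy_eq_tsum_indicator, ← ENNReal.ofReal_tsum_of_nonneg h0 h,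
    ENNReal.ofReal_div_of_pos (by norm_num), ENNReal.ofReal_ofNat, mul_comm, ENNReal.div_eq_inv_mul,
    mul_one, ENNReal.div_eq_inv_mul, mul_comm]

lemma pEnergy_univ_eq_ofReal {p : ℝ} {f : V → ℝ} (h : Summable (W.energyDensity p f)) :
    W.pEnergy p Set.univ f = ENNReal.ofReal ((∑' q, W.energyDensity p f q) / 2) := by
  simpa using W.pEnergy_eq_ofReal (S := Set.univ) (by simpa using h)

lemma tsum_energyDensity_le {p : ℝ} {v g : V → ℝ}
    (hE : W.pEnergy p Set.univ g < ∞) (h : W.pEnergy p Set.univ v ≤ W.pEnergy p Set.univ g) :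
    ∑' q, W.energyDensity p v q ≤ ∑' q, W.energyDensity p g q := by
  have h0 : 0 ≤ ∑' q, W.energyDensity p g q :=
    tsum_nonneg fun q => W.energyDensity_nonneg p _ q
  have hv := W.summable_energyDensity (h.trans_lt hE)
  rw [W.pEnergy_univ_eq_ofReal (W.summable_energyDensity hE), W.pEnergy_univ_eq_ofReal hv,
    ENNReal.ofReal_le_ofReal_iff (by linarith)] at h
  linarith

lemma energyDensity_le {p : ℝ} (hp : 1 < p) {f g : V → ℝ} {q : V × V}
    (h : |f q.1 - f q.2| ≤ |g q.1 - g q.2|) : W.energyDensity p f q ≤ W.energyDensity p g q :=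
  mul_le_mul_of_nonneg_left (Real.rpow_le_rpow (abs_nonneg _) h (by linarith))
    (W.weight_nonneg _ _)

/-- Energies are compared over the adjacent pairs that contribute to the smaller one. -/
lemma pEnergy_le_pEnergy_of_adj {p : ℝ} (hp : 1 < p) {S T : Set V} {f g : V → ℝ}
    (h : ∀ x ∈ S, ∀ y ∈ S, W.graph.Adj x y →
      f x = f y ∨ x ∈ T ∧ y ∈ T ∧ |f x - f y| ≤ |g x - g y|) :
    W.pEnergy p S f ≤ W.pEnergy p T g := by
  rw [pEnergy_eq_tsum_indicator, pEnergy_eq_tsum_indicator]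
  gcongr with q
  have h0 : 0 ≤ (T ×ˢ T).indicator (W.energyDensity p g) q :=
    Set.indicator_nonneg (fun q _ => W.energyDensity_nonneg p g q) q
  by_cases hq : q ∈ S ×ˢ S
  · rw [Set.indicator_of_mem hq]
    by_cases ha : W.graph.Adj q.1 q.2
    · rcases h _ hq.1 _ hq.2 ha with he | ⟨h1, h2, hle⟩
      · simpa [energyDensity, he, Real.zero_rpow (show p ≠ 0 by linarith)] using h0
      · rw [Set.indicator_of_mem (Set.mk_mem_prod h1 h2 : q ∈ T ×ˢ T)]
        exact W.energyDensity_le hp hle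
    · simpa [energyDensity, W.weight_eq_zero ha] using h0
  · rwa [Set.indicator_of_notMem hq]

lemma pEnergy_le_pEnergy {p : ℝ} (hp : 1 < p) {S T : Set V} (hST : S ⊆ T) {f g : V → ℝ}
    (h : ∀ x ∈ S, ∀ y ∈ S, |f x - f y| ≤ |g x - g y|) :
    W.pEnergy p S f ≤ W.pEnergy p T g :=
  W.pEnergy_le_pEnergy_of_adj hp fun x hx y hy _ => Or.inr ⟨hST hx, hST hy, h x hx y hy⟩

lemma pEnergy_const_mul {p : ℝ} (S : Set V) (c : ℝ) (f : V → ℝ) :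
    W.pEnergy p S (fun x => c * f x) = ENNReal.ofReal (|c| ^ p) * W.pEnergy p S f := by
  have h : ∀ x y : V, ENNReal.ofReal (W.weight x y * |c * f x - c * f y| ^ p) =
      ENNReal.ofReal (|c| ^ p) * ENNReal.ofReal (W.weight x y * |f x - f y| ^ p) := fun x y => by
    rw [← ENNReal.ofReal_mul (by positivity), ← mul_sub, abs_mul,
      Real.mul_rpow (abs_nonneg _) (abs_nonneg _)]
    congr 1
    ring
  simp_rw [pEnergy, h, ENNReal.tsum_mul_left]
  ring

lemma pEnergy_max_le {p : ℝ} (hp : 1 < p) (S : Set V) (f g : V → ℝ) :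
    W.pEnergy p S (fun x => max (f x) (g x)) ≤ W.pEnergy p S f + W.pEnergy p S g := by
  simp_rw [pEnergy_eq_tsum_indicator, ← mul_add, ← ENNReal.tsum_add]
  gcongr with q
  by_cases hq : q ∈ S ×ˢ S
  · simp only [Set.indicator_of_mem hq]
    have h := abs_max_sub_max_le_max (f q.1) (g q.1) (f q.2) (g q.2)
    rcases le_max_iff.1 h with h | h
    · exact (ENNReal.ofReal_le_ofReal (W.energyDensity_le hp h)).trans le_self_add
    · exact (ENNReal.ofReal_le_ofReal (W.energyDensity_le hp h)).trans le_add_self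
  · simp [Set.indicator_of_notMem hq]

lemma lowerSemicontinuous_pEnergy {p : ℝ} (hp : 1 < p) :
    LowerSemicontinuous fun f : V → ℝ => W.pEnergy p Set.univ f := by
  simp_rw [pEnergy_univ, ← ENNReal.tsum_mul_left]
  refine lowerSemicontinuous_tsum fun q => Continuous.lowerSemicontinuous ?_
  refine (ENNReal.continuous_const_mul (by simp)).comp (ENNReal.continuous_ofReal.comp ?_)
  exact continuous_const.mul
    (((continuous_apply q.1).sub (continuous_apply q.2)).abs.rpow_const
      fun _ => Or.inr (by linarith))

/-! ### Truncation to the unit interval -/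

/-- The truncation of a real number to `[0, 1]`. -/
noncomputable def clamp (t : ℝ) : ℝ := max 0 (min t 1)

lemma clamp_mem (t : ℝ) : clamp t ∈ Set.Icc (0 : ℝ) 1 :=
  ⟨le_max_left _ _, max_le zero_le_one (min_le_right _ _)⟩

lemma clamp_of_mem {t : ℝ} (h : t ∈ Set.Icc (0 : ℝ) 1) : clamp t = t := by
  rw [clamp, min_eq_left h.2, max_eq_right h.1]

lemma clamp_zero : clamp 0 = 0 := clamp_of_mem (by simp)

lemma clamp_one : clamp 1 = 1 := clamp_of_mem (by simp)

lemma abs_clamp_sub_clamp_le (s t : ℝ) : |clamp s - clamp t| ≤ |s - t| := by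
  refine (abs_max_sub_max_le_max _ _ _ _).trans (max_le (by simp) ?_)
  exact (abs_min_sub_min_le_max _ _ _ _).trans (by simp)

lemma pEnergy_clamp_le {p : ℝ} (hp : 1 < p) (S : Set V) (f : V → ℝ) :
    W.pEnergy p S (fun x => clamp (f x)) ≤ W.pEnergy p S f :=
  W.pEnergy_le_pEnergy hp subset_rfl fun _ _ _ _ => abs_clamp_sub_clamp_le _ _

/-! ### Conductance to infinity -/

lemma conductance_lt_iff {p : ℝ} {A B S : Set V} {c : ℝ≥0∞} :
    W.conductance p A B S < c ↔
      ∃ f : V → ℝ, (∀ x ∈ A, f x = 1) ∧ (∀ x ∈ B, f x = 0) ∧ W.pEnergy p S f < c := by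
  simp only [conductance, iInf_lt_iff, exists_prop]

lemma conductanceInfty_lt_iff {p : ℝ} {K S : Set V} {c : ℝ≥0∞} :
    W.conductanceInfty p K S < c ↔ ∃ (B : Finset V) (f : V → ℝ), (∀ x ∈ K, f x = 1) ∧
      (∀ x ∈ S \ (B : Set V), f x = 0) ∧ W.pEnergy p S f < c := by
  simp only [conductanceInfty, iInf_lt_iff, conductance_lt_iff]

lemma conductanceInfty_eq_zero_iff {p : ℝ} {K S : Set V} :
    W.conductanceInfty p K S = 0 ↔ ∀ c : ℝ≥0∞, 0 < c → W.conductanceInfty p K S < c :=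
  ⟨fun h c hc => h ▸ hc, fun h => by
    by_contra h'
    exact lt_irrefl _ (h _ (pos_iff_ne_zero.2 h'))⟩

lemma conductanceInfty_union_eq_zero {p : ℝ} (hp : 1 < p) {K L S : Set V}
    (hK : W.conductanceInfty p K S = 0) (hL : W.conductanceInfty p L S = 0) :
    W.conductanceInfty p (K ∪ L) S = 0 := by
  classical
  rw [conductanceInfty_eq_zero_iff] at *
  intro c hc
  obtain ⟨B, f, hf1, hf0, hf⟩ := W.conductanceInfty_lt_iff.1 (hK _ (ENNReal.half_pos hc.ne'))
  obtain ⟨B', g, hg1, hg0, hg⟩ := W.conductanceInfty_lt_iff.1 (hL _ (ENNReal.half_pos hc.ne'))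
  refine W.conductanceInfty_lt_iff.2
    ⟨B ∪ B', fun x => max (clamp (f x)) (clamp (g x)), ?_, ?_, ?_⟩
  · rintro x (hx | hx)
    · simp only [hf1 x hx, clamp_one]
      exact max_eq_left (clamp_mem _).2
    · simp only [hg1 x hx, clamp_one]
      exact max_eq_right (clamp_mem _).2
  · intro x hx
    have h : x ∉ B ∧ x ∉ B' := by simpa using hx.2
    simp [hf0 x ⟨hx.1, h.1⟩, hg0 x ⟨hx.1, h.2⟩, clamp_zero]
  · calc _ ≤ _ := W.pEnergy_max_le hp S _ _
      _ ≤ W.pEnergy p S f + W.pEnergy p S g :=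
        add_le_add (W.pEnergy_clamp_le hp S f) (W.pEnergy_clamp_le hp S g)
      _ < c / 2 + c / 2 := ENNReal.add_lt_add hf hg
      _ = c := ENNReal.add_halves c

/-- Non-parabolicity is already witnessed by a single vertex. -/
lemma exists_conductanceInfty_singleton_ne_zero {p : ℝ} (hp : 1 < p) {S : Set V}
    (h : ¬ W.IsParabolic p S) : ∃ x ∈ S, W.conductanceInfty p {x} S ≠ 0 := by
  by_contra! h'
  refine h fun K hK hKS => ?_
  induction K, hK using Set.Finite.induction_on with
  | empty =>
    rw [conductanceInfty_eq_zero_iff]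
    exact fun c hc => W.conductanceInfty_lt_iff.2
      ⟨∅, fun _ => 0, by simp, by simp, by
        simpa [pEnergy, Real.zero_rpow (show p ≠ 0 by linarith)] using hc⟩
  | insert _ _ ih =>
    rw [Set.insert_subset_iff] at hKS
    exact W.conductanceInfty_union_eq_zero hp (h' _ hKS.1) (ih hKS.2)

/-! ### Discrete harmonicity -/

section LocallyFinite

variable [W.graph.LocallyFinite]

/-- The divergence at `x` of the flux of `v`: up to the factor `μ(x)`, it is `-Δ_p v (x)`. -/
noncomputable def divergence (p : ℝ) (v : V → ℝ) (x : V) : ℝ :=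
  ∑ y ∈ W.graph.neighborFinset x, W.weight x y * pFlux p (v x - v y)

lemma pLaplacian_one_sub_eq_zero_iff {p : ℝ} {v : V → ℝ} {x : V} :
    W.pLaplacian p (fun x => 1 - v x) x = 0 ↔ W.divergence p v x = 0 := by
  have h : W.pLaplacian p (fun x => 1 - v x) x = 1 / W.vertexWeight x * W.divergence p v x := by
    simp [pLaplacian, divergence, pFlux]
  rw [h, mul_eq_zero, or_iff_right_iff_imp]
  intro h0
  -- If `μ(x)` vanishes, then every edge weight at `x` does.
  have h0 : W.vertexWeight x = 0 := by simpa using h0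
  rw [vertexWeight, Finset.sum_eq_zero_iff_of_nonneg fun y _ => W.weight_nonneg x y] at h0
  exact Finset.sum_eq_zero fun y hy => by rw [h0 y hy, zero_mul]

/-- The sum over all ordered pairs of a function supported on the edges issuing from a finite set
is a finite sum. -/
lemma hasSum_prod_neighborFinset {F : V → V → ℝ} {s : Finset V} (hs : ∀ x ∉ s, ∀ y, F x y = 0)
    (hF : ∀ x y, ¬ W.graph.Adj x y → F x y = 0) :
    HasSum (fun q : V × V => F q.1 q.2) (∑ x ∈ s, ∑ y ∈ W.graph.neighborFinset x, F x y) := by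
  classical
  set r : Finset (V × V) := (s ×ˢ s.biUnion fun x => W.graph.neighborFinset x).filter
    fun q => W.graph.Adj q.1 q.2 with hr
  have hmem : ∀ q : V × V, q ∈ r ↔ q.1 ∈ s ∧ q.2 ∈ W.graph.neighborFinset q.1 := fun q => by
    simp only [hr, Finset.mem_filter, Finset.mem_product, Finset.mem_biUnion,
      SimpleGraph.mem_neighborFinset]
    exact ⟨fun h => ⟨h.1.1, h.2⟩, fun h => ⟨⟨h.1, q.1, h⟩, h.2⟩⟩
  rw [← Finset.sum_finset_product' r s _ hmem]
  refine hasSum_sum_of_ne_finset_zero fun q hq => ?_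
  rw [hmem, not_and_or, SimpleGraph.mem_neighborFinset] at hq
  rcases hq with hq | hq
  · exact hs _ hq _
  · exact hF _ _ hq

/-- Summation by parts: the flux of `v` is orthogonal to the gradient of every finitely supported
`φ` that lives where `v` is `p`-harmonic. -/
lemma hasSum_flux_mul_grad (p : ℝ) {v φ : V → ℝ} {s : Finset V} (hs : ∀ x ∉ s, φ x = 0)
    (hφ : ∀ x ∈ s, φ x ≠ 0 → W.divergence p v x = 0) :
    HasSum (fun q : V × V =>
      W.weight q.1 q.2 * pFlux p (v q.1 - v q.2) * (φ q.1 - φ q.2)) 0 := by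
  have h := W.hasSum_prod_neighborFinset (s := s)
    (F := fun x y => W.weight x y * pFlux p (v x - v y) * φ x)
    (fun x hx y => by rw [hs x hx, mul_zero])
    (fun x y hxy => by rw [W.weight_eq_zero hxy, zero_mul, zero_mul])
  have h0 : ∑ x ∈ s, ∑ y ∈ W.graph.neighborFinset x,
      W.weight x y * pFlux p (v x - v y) * φ x = 0 := by
    refine Finset.sum_eq_zero fun x hx => ?_
    rw [← Finset.sum_mul]
    by_cases hx0 : φ x = 0
    · rw [hx0, mul_zero]
    · rw [← divergence, hφ x hx hx0, zero_mul]
  rw [h0] at h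
  have h' := (Equiv.prodComm V V).hasSum_iff.2 h
  have h2 := h.add h'
  rw [add_zero] at h2
  convert h2 using 1
  funext q
  simp only [Function.comp_apply, Equiv.prodComm_apply, Prod.fst_swap, Prod.snd_swap]
  rw [W.weight_symm q.2 q.1, ← neg_sub (v q.1), pFlux_neg]
  ring

end LocallyFinite

end WeightedGraph

/-! ### Boundaries and connected components -/

lemma SimpleGraph.Connected.exists_adj_mem_notMem {V : Type*} {G : SimpleGraph V}
    (hG : G.Connected) {S : Set V} (hS : S.Nonempty) (hS' : S ≠ Set.univ) :
    ∃ x ∈ S, ∃ y ∉ S, G.Adj x y := by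
  obtain ⟨a, ha⟩ := hS
  obtain ⟨b, hb⟩ := (Set.ne_univ_iff_exists_notMem S).1 hS'
  obtain ⟨w⟩ := hG.preconnected a b
  obtain ⟨d, -, h1, h2⟩ := w.exists_boundary_dart S ha hb
  exact ⟨d.fst, h1, d.snd, h2, d.adj⟩

/-- The connected component of `o` in the subgraph induced on `Ω`, as a set of vertices of the
ambient graph; it is built as the union of all connected subsets of `Ω` containing `o`. -/
lemma SimpleGraph.exists_induce_component {V : Type*} (G : SimpleGraph V) {Ω : Set V}
    {o : V} (ho : o ∈ Ω) :
    ∃ U ⊆ Ω, o ∈ U ∧ (G.induce U).Connected ∧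
      (∀ x ∈ U, ∀ y ∈ Ω, G.Adj x y → y ∈ U) ∧ ((G.induce Ω).Connected → U = Ω) := by
  set F : Set (Set V) := {s | s ⊆ Ω ∧ o ∈ s ∧ (G.induce s).Connected} with hF
  have hsingle : {o} ∈ F := ⟨Set.singleton_subset_iff.2 ho, rfl, by
    rw [SimpleGraph.connected_iff]
    exact ⟨SimpleGraph.Preconnected.of_subsingleton, ⟨⟨o, rfl⟩⟩⟩⟩
  have hsub : ⋃₀ F ⊆ Ω := Set.sUnion_subset fun s hs => hs.1
  have hoU : o ∈ ⋃₀ F := ⟨{o}, hsingle, rfl⟩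
  have hconn : (G.induce (⋃₀ F)).Connected :=
    SimpleGraph.induce_sUnion_connected_of_pairwise_not_disjoint ⟨_, hsingle⟩
      (fun hs ht => ⟨o, hs.2.1, ht.2.1⟩) fun hs => hs.2.2
  refine ⟨⋃₀ F, hsub, hoU, hconn, fun x hx y hy hxy => ?_,
    fun hΩ => hsub.antisymm fun y hy => ⟨Ω, ⟨subset_rfl, ho, hΩ⟩, hy⟩⟩
  refine ⟨⋃₀ F ∪ {x, y}, ⟨?_, Or.inl hoU, ?_⟩, Or.inr (Or.inr rfl)⟩
  · rintro z (hz | rfl | rfl)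
    exacts [hsub hz, hsub hx, hy]
  · exact SimpleGraph.induce_union_connected hconn.preconnected
      (SimpleGraph.induce_pair_connected_of_adj hxy).preconnected ⟨x, hx, Or.inl rfl⟩

/-! ### Massive sets have non-parabolic superlevel sets -/

namespace WeightedGraph

variable {V : Type*} (W : WeightedGraph V) [W.graph.LocallyFinite]

/-- A proper superlevel set of a function of finite energy is not `p`-parabolic if the function is
`p`-harmonic there: otherwise `(v - t)₊`, cut off by a function of small energy, is a test function
showing that no flux enters the superlevel set. -/
lemma not_isParabolic_superlevel (hconn : W.graph.Connected) {p : ℝ} (hp : 1 < p) {v : V → ℝ}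
    {t : ℝ} (hne : {x | t < v x}.Nonempty) (hne' : {x | t < v x} ≠ Set.univ)
    (hv1 : ∀ x, v x ≤ t + 1) (hdiv : ∀ x, t < v x → W.divergence p v x = 0)
    (hE : W.pEnergy p Set.univ v < ∞) : ¬ W.IsParabolic p {x | t < v x} := by
  classical
  set S : Set V := {x | t < v x} with hS
  obtain ⟨x₀, hx₀, y₀, hy₀, hadj⟩ := hconn.exists_adj_mem_notMem hne hne'
  have hx₀' : t < v x₀ := hx₀
  have hy₀' : v y₀ ≤ t := not_lt.1 hy₀
  have hsum := W.summable_energyDensity hE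
  set E := ∑' q, W.energyDensity p v q with hEdef
  have hE0 : 0 ≤ E := tsum_nonneg fun q => W.energyDensity_nonneg p v q
  set w : V → ℝ := fun x => max (v x - t) 0 with hw
  have hw0 : ∀ x, 0 ≤ w x := fun x => le_max_right _ _
  have hw1 : ∀ x, w x ≤ 1 := fun x => max_le (by linarith [hv1 x]) zero_le_one
  have hwS : ∀ x ∈ S, w x = v x - t := fun x hx => max_eq_left (by
    have : t < v x := hx
    linarith)
  have hwS' : ∀ x ∉ S, w x = 0 := fun x hx => max_eq_right (by
    have : v x ≤ t := not_lt.1 hx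
    linarith)
  -- The flux across the boundary edge `x₀ y₀`, weighted by the test function.
  set c : ℝ := W.weight x₀ y₀ * pFlux p (v x₀ - v y₀) * w x₀ with hc
  have hc0 : 0 < c := by
    have h1 := (W.weight_pos_iff x₀ y₀).2 hadj
    have h2 : 0 < pFlux p (v x₀ - v y₀) := pFlux_pos p (by linarith)
    have h3 : 0 < w x₀ := by
      rw [hwS x₀ hx₀]
      linarith
    positivity
  set ε : ℝ := c / (2 * (E + 1)) with hε
  have hε0 : 0 < ε := by positivity
  have hεE : ε * E < c / 2 := by
    have : ε * (E + 1) = c / 2 := by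
      rw [hε]
      field_simp
    linarith
  obtain ⟨C, hC, hY⟩ := exists_abs_pFlux_mul_le hp hε0
  intro hpar
  have hcap := hpar {x₀} (Set.finite_singleton x₀) (Set.singleton_subset_iff.2 hx₀)
  rw [conductanceInfty_eq_zero_iff] at hcap
  have hδ : 0 < c / (4 * C) := by positivity
  obtain ⟨B, f, hf1, hf0, hf⟩ :=
    W.conductanceInfty_lt_iff.1 (hcap _ (ENNReal.ofReal_pos.2 hδ))
  have hfx : f x₀ = 1 := hf1 x₀ rfl
  have hFsum := W.summable_indicator_energyDensity (hf.trans ENNReal.ofReal_lt_top)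
  rw [W.pEnergy_eq_ofReal hFsum, ENNReal.ofReal_lt_ofReal_iff hδ] at hf
  set F := (S ×ˢ S).indicator (W.energyDensity p f) with hF
  have hF0 : ∀ q, 0 ≤ F q := Set.indicator_nonneg fun q _ => W.energyDensity_nonneg p f q
  set φ : V → ℝ := fun x => w x * |f x| with hφ
  have hφ0 : ∀ x, 0 ≤ φ x := fun x => mul_nonneg (hw0 x) (abs_nonneg _)
  have hφS : ∀ x ∉ S, φ x = 0 := fun x hx => by simp only [hφ, hwS' x hx, zero_mul]
  have hgreen := W.hasSum_flux_mul_grad p (v := v) (φ := φ) (s := B)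
    (fun x hx => by
      by_cases hxS : x ∈ S
      · simp [hφ, hf0 x ⟨hxS, hx⟩]
      · exact hφS x hxS)
    (fun x _ hx => hdiv x (by
      by_contra hxS
      exact hx (hφS x hxS)))
  have htot := (hgreen.add (hsum.hasSum.mul_left ε)).add (hFsum.hasSum.mul_left C)
  have hnonneg : ∀ q : V × V, 0 ≤ W.weight q.1 q.2 * pFlux p (v q.1 - v q.2) * (φ q.1 - φ q.2) +
      ε * W.energyDensity p v q + C * F q := by
    rintro ⟨x, y⟩
    have hμ := W.weight_nonneg x y
    have h1 : 0 ≤ ε * W.energyDensity p v (x, y) :=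
      mul_nonneg hε0.le (W.energyDensity_nonneg p v _)
    have h2 : 0 ≤ C * F (x, y) := mul_nonneg hC.le (hF0 _)
    by_cases hx : x ∈ S <;> by_cases hy : y ∈ S
    · have hFq : F (x, y) = W.weight x y * |f x - f y| ^ p :=
        Set.indicator_of_mem (Set.mk_mem_prod hx hy) _
      have hsplit : φ x - φ y = |f x| * (v x - v y) + w y * (|f x| - |f y|) := by
        simp only [hφ, hwS x hx, hwS y hy]
        ring
      have h3 : 0 ≤ |f x| * (pFlux p (v x - v y) * (v x - v y)) := by
        rw [pFlux_mul_self hp]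
        positivity
      have h4 : -(|pFlux p (v x - v y)| * |f x - f y|) ≤
          w y * (pFlux p (v x - v y) * (|f x| - |f y|)) := by
        refine neg_le_of_abs_le ?_
        rw [abs_mul, abs_mul, abs_of_nonneg (hw0 y)]
        calc w y * (|pFlux p (v x - v y)| * |(|f x| - |f y|)|)
            ≤ 1 * (|pFlux p (v x - v y)| * |f x - f y|) :=
              mul_le_mul (hw1 y)
                (mul_le_mul_of_nonneg_left (abs_abs_sub_abs_le (f x) (f y)) (abs_nonneg _))
                (by positivity) zero_le_one
          _ = _ := one_mul _
      have h5 := hY (v x - v y) (f x - f y)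
      simp only [energyDensity, hFq, hsplit]
      have h6 : 0 ≤ W.weight x y * (|f x| * (pFlux p (v x - v y) * (v x - v y)) +
          w y * (pFlux p (v x - v y) * (|f x| - |f y|)) + ε * |v x - v y| ^ p +
          C * |f x - f y| ^ p) := mul_nonneg hμ (by linarith)
      linarith
    · have hle : v y ≤ t := not_lt.1 hy
      have hlt : t < v x := hx
      have h3 := pFlux_nonneg p (show 0 ≤ v x - v y by linarith)
      have h4 := hφ0 x
      have : 0 ≤ W.weight x y * pFlux p (v x - v y) * (φ x - φ y) := by
        rw [hφS y hy, sub_zero]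
        positivity
      simp only
      linarith
    · have hle : v x ≤ t := not_lt.1 hx
      have hlt : t < v y := hy
      have h3 := pFlux_nonneg p (show 0 ≤ v y - v x by linarith)
      have h4 := hφ0 y
      have : 0 ≤ W.weight x y * pFlux p (v x - v y) * (φ x - φ y) := by
        rw [hφS x hx, zero_sub, ← neg_sub (v y), pFlux_neg, mul_neg, mul_neg,
          neg_mul, neg_neg]
        positivity
      simp only
      linarith
    · simp only [hφS x hx, hφS y hy, sub_zero, mul_zero]
      linarith
  have hle := le_hasSum htot (x₀, y₀) fun q _ => hnonneg q
  have hval : c ≤ W.weight x₀ y₀ * pFlux p (v x₀ - v y₀) * (φ x₀ - φ y₀) +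
      ε * W.energyDensity p v (x₀, y₀) + C * F (x₀, y₀) := by
    have h1 : 0 ≤ ε * W.energyDensity p v (x₀, y₀) :=
      mul_nonneg hε0.le (W.energyDensity_nonneg p v _)
    have h2 : 0 ≤ C * F (x₀, y₀) := mul_nonneg hC.le (hF0 _)
    have h3 : φ x₀ - φ y₀ = w x₀ := by
      rw [hφS y₀ hy₀]
      simp [hφ, hfx]
    rw [h3]
    linarith
  have hCF : C * ∑' q, F q < c / 2 := by
    rw [div_lt_div_iff₀ (by norm_num) (by positivity)] at hf
    linarith
  simp only at hle
  linarith

/-- A `D_p`-massive set contains a non-parabolic subset of finite relative capacity, namely a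
superlevel set of `1 - u`. -/
lemma IsDpMassive.exists_not_isParabolic (hconn : W.graph.Connected) {p : ℝ} (hp : 1 < p)
    {Ω : Set V} (hΩ : Ω.Nonempty) (hΩ' : Ω ≠ Set.univ) (h : W.IsDpMassive p Ω) :
    ∃ Ω₁ ⊆ Ω, ¬ W.IsParabolic p Ω₁ ∧ W.capacity p Ω₁ Ω < ∞ := by
  obtain ⟨u, hu, hharm, hu1, hE⟩ := h
  obtain ⟨a, ha⟩ := hΩ
  set v : V → ℝ := fun x => 1 - u x with hv
  have huv : u = fun x => 1 - v x := by
    funext x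
    simp [hv]
  have hEv : W.pEnergy p Set.univ v < ∞ :=
    (W.pEnergy_le_pEnergy hp subset_rfl fun x _ y _ => by
      rw [abs_sub_comm]
      simp [hv]).trans_lt hE
  set t : ℝ := v a / 2 with ht
  have hva : 0 < v a := by
    have := (hu a ha).2
    simp only [hv]
    linarith
  have ht0 : 0 < t := half_pos hva
  have hv0 : ∀ x ∉ Ω, v x = 0 := fun x hx => by simp [hv, hu1 x hx]
  have hsub : {x | t < v x} ⊆ Ω := fun x hx => by
    by_contra hxΩ
    have hlt : t < v x := hx
    rw [hv0 x hxΩ] at hlt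
    linarith
  refine ⟨{x | t < v x}, hsub, ?_, ?_⟩
  · refine W.not_isParabolic_superlevel hconn hp ⟨a, half_lt_self hva⟩
      (fun h => hΩ' (Set.eq_univ_of_univ_subset (h ▸ hsub))) (fun x => ?_) (fun x hx => ?_) hEv
    · by_cases hx : x ∈ Ω
      · have := (hu x hx).1
        simp only [hv]
        linarith
      · rw [hv0 x hx]
        linarith
    · have := hharm x (hsub hx)
      rwa [huv, pLaplacian_one_sub_eq_zero_iff] at this
  · refine W.conductance_lt_iff.2 ⟨fun x => clamp (t⁻¹ * v x), fun x hx => ?_, fun x hx => ?_, ?_⟩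
    · have hlt : t < v x := hx
      have : 1 ≤ t⁻¹ * v x := by
        rw [inv_mul_eq_div, one_le_div ht0]
        exact hlt.le
      simp [clamp, min_eq_right this]
    · simp [hv0 x hx, clamp_zero]
    · refine (W.pEnergy_clamp_le hp _ _).trans_lt ?_
      rw [pEnergy_const_mul]
      exact ENNReal.mul_lt_top ENNReal.ofReal_lt_top hEv

end WeightedGraph

open Filter Topology

namespace WeightedGraph

variable {V : Type*} (W : WeightedGraph V)

/-! ### Energy minimisers with finitely many free values -/

section Minimiser

variable [W.graph.LocallyFinite]

/-- The Euler–Lagrange equation at a single vertex. -/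
lemma divergence_eq_zero_of_pEnergy_le {p : ℝ} (hp : 1 < p) {v : V → ℝ} {x : V} [DecidableEq V]
    (hE : W.pEnergy p Set.univ v < ∞)
    (hmin : ∀ s, W.pEnergy p Set.univ v ≤ W.pEnergy p Set.univ (Function.update v x s)) :
    W.divergence p v x = 0 := by
  have hsum := W.summable_energyDensity hE
  set Φ : ℝ → ℝ := fun s => ∑ y ∈ W.graph.neighborFinset x, W.weight x y * |s - v y| ^ p with hΦ
  have hloc : IsLocalMin Φ (v x) := by
    refine Filter.Eventually.of_forall fun s => ?_
    -- `F` collects the change of energy on the edges issuing from `x`.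
    set F : V → V → ℝ := fun z y =>
      if z = x then W.weight z y * (|s - v y| ^ p - |v x - v y| ^ p) else 0 with hF
    have hFsum := W.hasSum_prod_neighborFinset (F := F) (s := {x})
      (fun z hz y => if_neg (by simpa using hz))
      (fun z y hzy => by simp [hF, W.weight_eq_zero hzy])
    have hFval : ∑ z ∈ {x}, ∑ y ∈ W.graph.neighborFinset z, F z y = Φ s - Φ (v x) := by
      simp [hF, hΦ, mul_sub]
    rw [hFval] at hFsum
    have htot := hsum.hasSum.add (hFsum.add ((Equiv.prodComm V V).hasSum_iff.2 hFsum))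
    have hden : ∀ q : V × V, W.energyDensity p (Function.update v x s) q =
        W.energyDensity p v q + (F q.1 q.2 + F q.2 q.1) := by
      rintro ⟨z, y⟩
      simp only [energyDensity, hF]
      by_cases hz : z = x <;> by_cases hy : y = x
      · subst hz
        subst hy
        simp [W.weight_eq_zero (W.graph.loopless.irrefl y)]
      · subst hz
        simp only [Function.update_self, Function.update_of_ne hy, if_true, if_neg hy]
        ring
      · subst hy
        simp only [Function.update_self, Function.update_of_ne hz, if_true, if_neg hz]
        rw [abs_sub_comm (v z) s, abs_sub_comm (v z) (v y), W.weight_symm z y]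
        ring
      · simp [hz, hy]
    have hsum' : HasSum (W.energyDensity p (Function.update v x s)) _ :=
      htot.congr_fun (fun q => hden q)
    have hle := hmin s
    rw [W.pEnergy_univ_eq_ofReal hsum, W.pEnergy_univ_eq_ofReal hsum'.summable, hsum'.tsum_eq] at hle
    have h0 : 0 ≤ ∑' q, W.energyDensity p (Function.update v x s) q :=
      tsum_nonneg fun q => W.energyDensity_nonneg p _ q
    rw [hsum'.tsum_eq] at h0
    rw [ENNReal.ofReal_le_ofReal_iff (by linarith)] at hle
    linarith
  have hder : HasDerivAt Φ (p * W.divergence p v x) (v x) := by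
    rw [divergence, Finset.mul_sum]
    refine HasDerivAt.fun_sum fun y _ => ?_
    have h := ((hasDerivAt_abs_rpow (v x - v y) hp).comp_sub_const (v x) (v y)).const_mul
      (W.weight x y)
    refine HasDerivAt.congr_deriv h ?_
    simp only [pFlux]
    ring
  have h := hloc.hasDerivAt_eq_zero hder
  exact (mul_eq_zero.1 h).resolve_left (by linarith)

/-- A function `g` of finite energy with values in `[0, 1]` can be made `p`-harmonic on a finite
set `A` without changing it elsewhere and without increasing its energy. -/
lemma exists_divergence_eq_zero_on {p : ℝ} (hp : 1 < p) {g : V → ℝ}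
    (hg : ∀ x, g x ∈ Set.Icc (0 : ℝ) 1) (hE : W.pEnergy p Set.univ g < ∞) (A : Finset V) :
    ∃ v : V → ℝ, (∀ x, v x ∈ Set.Icc (0 : ℝ) 1) ∧ (∀ x ∉ A, v x = g x) ∧
      W.pEnergy p Set.univ v ≤ W.pEnergy p Set.univ g ∧ ∀ x ∈ A, W.divergence p v x = 0 := by
  classical
  set K : Set (V → ℝ) :=
    Set.pi Set.univ fun x => if x ∈ A then Set.Icc (0 : ℝ) 1 else {g x} with hK
  have hmemK : ∀ f : V → ℝ, (∀ x, f x ∈ Set.Icc (0 : ℝ) 1) → (∀ x ∉ A, f x = g x) → f ∈ K := by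
    intro f hf hf' x _
    by_cases hx : x ∈ A
    · simpa only [if_pos hx] using hf x
    · simpa only [if_neg hx, Set.mem_singleton_iff] using hf' x hx
  have hKc : IsCompact K := isCompact_univ_pi fun x => by
    split_ifs
    · exact isCompact_Icc
    · exact isCompact_singleton
  have hgK : g ∈ K := hmemK g hg fun _ _ => rfl
  obtain ⟨v, hvK, hvmin⟩ := LowerSemicontinuousOn.exists_isMinOn ⟨g, hgK⟩ hKc
    ((W.lowerSemicontinuous_pEnergy hp).lowerSemicontinuousOn K)
  rw [isMinOn_iff] at hvmin
  have hv' : ∀ x ∉ A, v x = g x := fun x hx => by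
    have := hvK x trivial
    simpa only [if_neg hx, Set.mem_singleton_iff] using this
  have hv : ∀ x, v x ∈ Set.Icc (0 : ℝ) 1 := fun x => by
    by_cases hx : x ∈ A
    · have := hvK x trivial
      simpa only [if_pos hx] using this
    · exact hv' x hx ▸ hg x
  refine ⟨v, hv, hv', hvmin g hgK, fun x hx => ?_⟩
  refine W.divergence_eq_zero_of_pEnergy_le hp ((hvmin g hgK).trans_lt hE) fun s => ?_
  -- Truncation turns an arbitrary variation into a competitor with values in `[0, 1]`.
  refine (hvmin (fun y => clamp (Function.update v x s y))
    (hmemK _ (fun y => clamp_mem _) fun y hy => ?_)).trans (W.pEnergy_clamp_le hp _ _)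
  rw [Function.update_of_ne (ne_of_mem_of_not_mem hx hy).symm, hv' y hy, clamp_of_mem (hg y)]

/-! ### Vanishing limits of minimisers -/

/-- If finite harmonic modifications `v i` of `g` tend to `0` pointwise, then their energies tend
to `0`. Indeed `v i - g` is an admissible test function, so the energy of `v i` equals the pairing
of its flux with the gradient of `g`; the latter is uniformly small outside a finite set of edges
and tends to `0` on this set. -/
lemma eventually_tsum_energyDensity_lt {p : ℝ} (hp : 1 < p) {ι : Type*} {l : Filter ι}
    {v : ι → V → ℝ} {g : V → ℝ} {A : ι → Finset V} (hE : W.pEnergy p Set.univ g < ∞)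
    (hle : ∀ i, W.pEnergy p Set.univ (v i) ≤ W.pEnergy p Set.univ g)
    (hA : ∀ i, ∀ x ∉ A i, v i x = g x) (hdiv : ∀ i, ∀ x ∈ A i, W.divergence p (v i) x = 0)
    (hlim : ∀ x, Tendsto (fun i => v i x) l (𝓝 0)) {η : ℝ} (hη : 0 < η) :
    ∀ᶠ i in l, ∑' q, W.energyDensity p (v i) q < η := by
  classical
  have hgsum := W.summable_energyDensity hE
  set G := ∑' q, W.energyDensity p g q with hG
  have hG0 : 0 ≤ G := tsum_nonneg fun q => W.energyDensity_nonneg p _ q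
  set ε : ℝ := η / (4 * (G + 1)) with hε
  have hε0 : 0 < ε := by positivity
  have hεG : ε * G < η / 4 := by
    have : ε * (G + 1) = η / 4 := by
      rw [hε]
      field_simp
    linarith
  obtain ⟨C, hC, hY⟩ := exists_abs_pFlux_mul_le hp hε0
  obtain ⟨F, hF⟩ : ∃ F : Finset (V × V), G - η / (4 * C) < ∑ q ∈ F, W.energyDensity p g q :=
    (hgsum.hasSum.eventually (lt_mem_nhds (sub_lt_self G (by positivity)))).exists
  have hF' : C * G - C * ∑ q ∈ F, W.energyDensity p g q < η / 4 := by
    have h1 : G - ∑ q ∈ F, W.energyDensity p g q < η / (4 * C) := by linarith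
    rw [lt_div_iff₀ (by positivity)] at h1
    linarith
  set P : ι → V × V → ℝ := fun i q =>
    W.weight q.1 q.2 * (|pFlux p (v i q.1 - v i q.2)| * |g q.1 - g q.2|) with hP
  have hPlim : Tendsto (fun i => ∑ q ∈ F, P i q) l (𝓝 0) := by
    rw [← Finset.sum_const_zero (s := F)]
    refine tendsto_finsetSum _ fun q _ => ?_
    have h1 : Tendsto (fun i => pFlux p (v i q.1 - v i q.2)) l (𝓝 0) := by
      have := (continuous_pFlux hp).continuousAt.tendsto.comp ((hlim q.1).sub (hlim q.2))
      simpa [pFlux_zero, Function.comp_def] using this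
    simpa using (h1.abs.mul_const |g q.1 - g q.2|).const_mul (W.weight q.1 q.2)
  filter_upwards [hPlim.eventually (gt_mem_nhds (show (0 : ℝ) < η / 4 by positivity))] with i hi
  have hvsum := W.summable_energyDensity ((hle i).trans_lt hE)
  have hEle := W.tsum_energyDensity_le hE (hle i)
  have hgreen := W.hasSum_flux_mul_grad p (v := v i) (φ := fun x => v i x - g x) (s := A i)
    (fun x hx => by simp only [hA i x hx, sub_self]) (fun x hx _ => hdiv i x hx)
  have hb : HasSum (fun q => if q ∈ F then P i q - C * W.energyDensity p g q else 0)
      (∑ q ∈ F, (P i q - C * W.energyDensity p g q)) := by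
    rw [← Finset.sum_congr rfl fun q hq =>
      if_pos (c := q ∈ F) (t := P i q - C * W.energyDensity p g q) (e := 0) hq]
    exact hasSum_sum_of_ne_finset_zero fun q hq => if_neg hq
  have htot := ((hgreen.add (hvsum.hasSum.mul_left ε)).add (hgsum.hasSum.mul_left C)).add hb
  have hkey := hasSum_le (fun q => ?_) hvsum.hasSum htot
  · rw [Finset.sum_sub_distrib, ← Finset.mul_sum] at hkey
    have : ε * ∑' q, W.energyDensity p (v i) q ≤ ε * G := by gcongr
    linarith
  · have hμ := W.weight_nonneg q.1 q.2
    have hvq := W.energyDensity_nonneg p (v i) q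
    -- The energy density is the flux paired with the gradient of `v i` itself.
    have h1 : W.weight q.1 q.2 * pFlux p (v i q.1 - v i q.2) *
        (v i q.1 - g q.1 - (v i q.2 - g q.2)) = W.energyDensity p (v i) q -
          W.weight q.1 q.2 * (pFlux p (v i q.1 - v i q.2) * (g q.1 - g q.2)) := by
      rw [energyDensity, ← pFlux_mul_self hp]
      ring
    have h2 : W.weight q.1 q.2 * (pFlux p (v i q.1 - v i q.2) * (g q.1 - g q.2)) ≤ P i q := by
      simp only [hP, ← abs_mul]
      gcongr
      exact le_abs_self _
    have h3 : P i q ≤ ε * W.energyDensity p (v i) q + C * W.energyDensity p g q := by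
      have := mul_le_mul_of_nonneg_left (hY (v i q.1 - v i q.2) (g q.1 - g q.2)) hμ
      simp only [hP, energyDensity]
      linarith
    simp only [h1]
    have h4 : 0 ≤ ε * W.energyDensity p (v i) q := by positivity
    split_ifs <;> linarith

/-! ### The strong maximum principle -/

lemma eq_of_divergence_eq_zero_of_le {p : ℝ} {v : V → ℝ} {x : V} (h : W.divergence p v x = 0)
    (hle : ∀ y, v y ≤ v x) {y : V} (hy : W.graph.Adj x y) : v y = v x := by
  rw [divergence, Finset.sum_eq_zero_iff_of_nonneg fun z _ =>
    mul_nonneg (W.weight_nonneg x z) (pFlux_nonneg p (sub_nonneg.2 (hle z)))] at h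
  have h' := h y ((W.graph.mem_neighborFinset x y).2 hy)
  by_contra hne
  have hlt : v y < v x := lt_of_le_of_ne (hle y) hne
  exact (mul_pos ((W.weight_pos_iff x y).2 hy) (pFlux_pos p (sub_pos.2 hlt))).ne' h'

lemma eq_of_divergence_eq_zero_of_ge {p : ℝ} {v : V → ℝ} {x : V} (h : W.divergence p v x = 0)
    (hle : ∀ y, v x ≤ v y) {y : V} (hy : W.graph.Adj x y) : v y = v x := by
  have h' : W.divergence p (fun y => -v y) x = 0 := by
    have : ∀ y, -v x - -v y = -(v x - v y) := fun y => by ring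
    rw [divergence] at h ⊢
    simp only [this, pFlux_neg, mul_neg, Finset.sum_neg_distrib, h, neg_zero]
  exact neg_injective
    (W.eq_of_divergence_eq_zero_of_le h' (fun y => neg_le_neg (hle y)) hy)

/-! ### Construction of the massive function -/

lemma continuous_divergence {p : ℝ} (hp : 1 < p) (x : V) :
    Continuous fun v : V → ℝ => W.divergence p v x :=
  continuous_finsetSum _ fun y _ => continuous_const.mul
    ((continuous_pFlux hp).comp ((continuous_apply x).sub (continuous_apply y)))

/-- A connected proper subset `U` is `D_p`-massive as soon as some function `g` of finite energy
vanishes off `U` and equals `1` on a set `S` that is not `p`-parabolic. -/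
lemma isDpMassive_of_conductanceInfty_ne_zero (hconn : W.graph.Connected) {p : ℝ} (hp : 1 < p)
    {U S : Set V} (hU : (W.graph.induce U).Connected) (hU' : U ≠ Set.univ) {g : V → ℝ}
    (hg : ∀ x, g x ∈ Set.Icc (0 : ℝ) 1) (hgU : ∀ x ∉ U, g x = 0) (hgS : ∀ x ∈ S, g x = 1)
    (hE : W.pEnergy p Set.univ g < ∞) {o : V} (ho : o ∈ S)
    (hcap : W.conductanceInfty p {o} S ≠ 0) : W.IsDpMassive p U := by
  classical
  choose v hvI hvA hvE hvdiv using fun B : Finset V =>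
    W.exists_divergence_eq_zero_on hp hg hE (B.filter (· ∈ U))
  -- A pointwise limit of the minimisers, along an ultrafilter of finite sets.
  set l : Ultrafilter (Finset V) := Ultrafilter.of atTop with hl
  have hl' : (l : Filter (Finset V)) ≤ atTop := Ultrafilter.of_le _
  have hKc : IsCompact (Set.pi Set.univ fun _ : V => Set.Icc (0 : ℝ) 1) :=
    isCompact_univ_pi fun _ => isCompact_Icc
  obtain ⟨z, hz, hlim⟩ := isCompact_iff_ultrafilter_le_nhds.1 hKc (l.map v)
    (le_principal_iff.2 (Filter.mem_map.2 (Filter.univ_mem' fun B x _ => hvI B x)))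
  have hlim : Tendsto v l (𝓝 z) := hlim
  have hlimx : ∀ x, Tendsto (fun B => v B x) l (𝓝 (z x)) := tendsto_pi_nhds.1 hlim
  have hz0 : ∀ x, 0 ≤ z x := fun x => (hz x trivial).1
  have hz1 : ∀ x, z x ≤ 1 := fun x => (hz x trivial).2
  have hzU : ∀ x ∉ U, z x = 0 := fun x hx => by
    refine tendsto_nhds_unique (hlimx x) (tendsto_const_nhds.congr fun B => ?_)
    rw [hvA B x (by simp [hx]), hgU x hx]
  have hzE : W.pEnergy p Set.univ z ≤ W.pEnergy p Set.univ g :=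
    ((W.lowerSemicontinuous_pEnergy hp).isClosed_preimage _).mem_of_tendsto hlim
      (Filter.Eventually.of_forall hvE)
  have hzdiv : ∀ x ∈ U, W.divergence p z x = 0 := fun x hx => by
    refine tendsto_nhds_unique (((W.continuous_divergence hp x).tendsto z).comp hlim)
      (tendsto_const_nhds.congr' ?_)
    filter_upwards [hl' (mem_atTop ({x} : Finset V))] with B hB
    exact (hvdiv B x (by simpa [hx] using hB)).symm
  -- If the limit vanished, then `g - v B` would show that `S` has no conductance to infinity.
  have hzne : ∃ x, z x ≠ 0 := by
    by_contra! hz0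
    simp only [hz0] at hlimx
    obtain ⟨r, hr0, hr⟩ := ENNReal.lt_iff_exists_nnreal_btwn.1 (pos_iff_ne_zero.2 hcap)
    have hr0 : (0 : ℝ) < r := by exact_mod_cast hr0
    have h2p : (0 : ℝ) < 2 ^ p := by positivity
    have hsmall := W.eventually_tsum_energyDensity_lt hp hE hvE hvA hvdiv hlimx
      (show 0 < 2 * (r / 2 ^ p : ℝ) by positivity)
    have hhalf := (hlimx o).eventually (gt_mem_nhds (show (0 : ℝ) < 1 / 2 by norm_num))
    obtain ⟨B, hB, hBo⟩ := (hsmall.and hhalf).exists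
    refine lt_irrefl (W.conductanceInfty p {o} S) (W.conductanceInfty_lt_iff.2
      ⟨B, fun x => (1 - v B o)⁻¹ * (g x - v B x), ?_, ?_, ?_⟩)
    · rintro x rfl
      simp only
      rw [hgS x ho, inv_mul_cancel₀ (by linarith)]
    · intro x hx
      have hxB : x ∉ B := by simpa using hx.2
      simp only
      rw [hvA B x (by simp [hxB]), sub_self, mul_zero]
    · have hk : |(1 - v B o)⁻¹| ≤ 2 := by
        rw [abs_of_pos (inv_pos.2 (by linarith))]
        exact inv_le_of_inv_le₀ (by norm_num) (by linarith)
      have hcmp : W.pEnergy p S (fun x => g x - v B x) ≤ W.pEnergy p Set.univ (v B) :=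
        W.pEnergy_le_pEnergy hp (Set.subset_univ S) fun x hx y hy => by
          rw [hgS x hx, hgS y hy, abs_sub_comm]
          simp
      have hvsum := W.summable_energyDensity ((hvE B).trans_lt hE)
      rw [pEnergy_const_mul]
      refine lt_of_le_of_lt ?_ hr
      calc ENNReal.ofReal (|(1 - v B o)⁻¹| ^ p) * W.pEnergy p S (fun x => g x - v B x)
          ≤ ENNReal.ofReal (2 ^ p) * W.pEnergy p Set.univ (v B) := by gcongr
        _ = ENNReal.ofReal (2 ^ p * ((∑' q, W.energyDensity p (v B) q) / 2)) := by
          rw [W.pEnergy_univ_eq_ofReal hvsum, ENNReal.ofReal_mul h2p.le]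
        _ ≤ ENNReal.ofReal (r : ℝ) := by
          refine ENNReal.ofReal_le_ofReal ?_
          have h1 : (∑' q, W.energyDensity p (v B) q) / 2 ≤ r / 2 ^ p := by linarith
          rw [le_div_iff₀ h2p] at h1
          linarith
        _ = r := ENNReal.ofReal_coe_nnreal
  have hpos : ∀ x ∈ U, 0 < z x := by
    intro x hx
    by_contra hx0
    have hx0 : z x = 0 := le_antisymm (not_lt.1 hx0) (hz0 x)
    obtain ⟨b, hb⟩ := hzne
    have hbU : b ∈ U := by
      by_contra hbU
      exact hb (hzU b hbU)
    obtain ⟨a, ha, c, hc, hac⟩ := hU.exists_adj_mem_notMem (S := {a : U | z a = 0})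
      ⟨⟨x, hx⟩, hx0⟩ ((Set.ne_univ_iff_exists_notMem _).2 ⟨⟨b, hbU⟩, hb⟩)
    have ha : z a = 0 := ha
    exact hc ((W.eq_of_divergence_eq_zero_of_ge (hzdiv a a.2) (fun y => ha ▸ hz0 y) hac).trans ha)
  have hlt : ∀ x, z x < 1 := by
    intro x
    by_contra hx1
    have hx1 : z x = 1 := le_antisymm (hz1 x) (not_lt.1 hx1)
    obtain ⟨b, hb⟩ := (Set.ne_univ_iff_exists_notMem U).1 hU'
    obtain ⟨a, ha, c, hc, hac⟩ := hconn.exists_adj_mem_notMem (S := {a | z a = 1})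
      ⟨x, hx1⟩ ((Set.ne_univ_iff_exists_notMem _).2 ⟨b, by simp [hzU b hb]⟩)
    have ha : z a = 1 := ha
    have haU : a ∈ U := by
      by_contra haU
      rw [hzU a haU] at ha
      exact zero_ne_one ha
    exact hc ((W.eq_of_divergence_eq_zero_of_le (hzdiv a haU) (fun y => ha ▸ hz1 y) hac).trans ha)
  refine ⟨fun x => 1 - z x, fun x hx => ⟨by linarith [hlt x], by linarith [hpos x hx]⟩,
    fun x hx => W.pLaplacian_one_sub_eq_zero_iff.2 (hzdiv x hx), fun x hx => by simp [hzU x hx],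
    ?_⟩
  refine ((W.pEnergy_le_pEnergy hp subset_rfl fun x _ y _ => ?_).trans hzE).trans_lt hE
  rw [abs_sub_comm]
  simp

end Minimiser

/-! ### The capacitary condition -/

/-- A non-parabolic subset of finite relative capacity in `Ω` makes some connected component of
`Ω` massive. -/
lemma exists_isDpMassive [W.graph.LocallyFinite] (hconn : W.graph.Connected) {p : ℝ} (hp : 1 < p)
    {Ω Ω₁ : Set V} (hΩ' : Ω ≠ Set.univ) (hsub : Ω₁ ⊆ Ω) (hpar : ¬ W.IsParabolic p Ω₁)
    (hcap : W.capacity p Ω₁ Ω < ∞) :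
    ∃ U ⊆ Ω, (W.graph.induce U).Connected ∧ W.IsDpMassive p U ∧
      ((W.graph.induce Ω).Connected → U = Ω) := by
  classical
  obtain ⟨o, ho, hoc⟩ := W.exists_conductanceInfty_singleton_ne_zero hp hpar
  obtain ⟨f, hf1, hf0, hfE⟩ := W.conductance_lt_iff.1 hcap
  obtain ⟨U, hUΩ, hoU, hUconn, hUadj, hUeq⟩ := W.graph.exists_induce_component (hsub ho)
  -- Edges leaving `U` leave `Ω`.
  have hadj : ∀ x ∈ U, ∀ y ∉ U, W.graph.Adj x y → y ∉ Ω := fun x hx y hy hxy hyΩ =>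
    hy (hUadj x hx y hyΩ hxy)
  refine ⟨U, hUΩ, hUconn, ?_, hUeq⟩
  set g : V → ℝ := U.indicator fun x => clamp (f x) with hg
  have hgU : ∀ x ∈ U, g x = clamp (f x) := fun x hx => Set.indicator_of_mem hx _
  have hgU' : ∀ x ∉ U, g x = 0 := fun x hx => Set.indicator_of_notMem hx _
  have hgE : W.pEnergy p Set.univ g < ∞ := by
    refine (W.pEnergy_le_pEnergy_of_adj hp fun x _ y _ hxy => ?_).trans_lt hfE
    by_cases hx : x ∈ U <;> by_cases hy : y ∈ U
    · rw [hgU x hx, hgU y hy]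
      exact Or.inr ⟨trivial, trivial, abs_clamp_sub_clamp_le _ _⟩
    · have hfy : f y = 0 := hf0 y (hadj x hx y hy hxy)
      rw [hgU x hx, hgU' y hy, ← clamp_zero, ← hfy]
      exact Or.inr ⟨trivial, trivial, abs_clamp_sub_clamp_le _ _⟩
    · have hfx : f x = 0 := hf0 x (hadj y hy x hx hxy.symm)
      rw [hgU y hy, hgU' x hx, ← clamp_zero, ← hfx]
      exact Or.inr ⟨trivial, trivial, abs_clamp_sub_clamp_le _ _⟩
    · exact Or.inl (by rw [hgU' x hx, hgU' y hy])
  refine W.isDpMassive_of_conductanceInfty_ne_zero hconn hp (S := Ω₁ ∩ U) (g := g) (o := o) hUconn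
    (fun h => hΩ' (Set.eq_univ_of_univ_subset (h ▸ hUΩ))) (fun x => ?_) hgU' (fun x hx => ?_) hgE
    ⟨ho, hoU⟩ fun h => hoc ?_
  · by_cases hx : x ∈ U
    · exact hgU x hx ▸ clamp_mem _
    · simp [hgU' x hx]
  · rw [hgU x hx.2, hf1 x hx.1, clamp_one]
  · -- Competitors on `Ω₁ ∩ U` extend by zero to competitors on `Ω₁` of the same energy.
    rw [conductanceInfty_eq_zero_iff] at h ⊢
    intro c hc
    obtain ⟨B, k, hk1, hk0, hkE⟩ := W.conductanceInfty_lt_iff.1 (h c hc)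
    refine W.conductanceInfty_lt_iff.2 ⟨B, U.indicator k, ?_, ?_, ?_⟩
    · rintro x rfl
      rw [Set.indicator_of_mem hoU, hk1 x rfl]
    · intro x hx
      by_cases hxU : x ∈ U
      · rw [Set.indicator_of_mem hxU, hk0 x ⟨⟨hx.1, hxU⟩, hx.2⟩]
      · rw [Set.indicator_of_notMem hxU]
    · refine (W.pEnergy_le_pEnergy_of_adj hp fun x hx y hy hxy => ?_).trans_lt hkE
      by_cases hxU : x ∈ U <;> by_cases hyU : y ∈ U
      · rw [Set.indicator_of_mem hxU, Set.indicator_of_mem hyU]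
        exact Or.inr ⟨⟨hx, hxU⟩, ⟨hy, hyU⟩, le_rfl⟩
      · exact absurd (hsub hy) (hadj x hxU y hyU hxy)
      · exact absurd (hsub hx) (hadj y hyU x hxU hxy.symm)
      · rw [Set.indicator_of_notMem hxU, Set.indicator_of_notMem hyU]
        exact Or.inl rfl

lemma capacity_anti (p : ℝ) (K : Set V) {U Ω : Set V} (h : U ⊆ Ω) :
    W.capacity p K Ω ≤ W.capacity p K U :=
  iInf_mono fun _ => iInf_mono fun _ => iInf_mono' fun hf =>
    ⟨fun x hx => hf x fun hxU => hx (h hxU), le_rfl⟩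

end WeightedGraph

theorem theorem1p4 {V : Type*} [Infinite V] (W : WeightedGraph V) [W.graph.LocallyFinite]
    (hconn : W.graph.Connected) (p : ℝ) (hp : 1 < p)
    (Ω : Set V) (hΩ : Ω.Nonempty) (hΩ' : Ω ≠ Set.univ) :
    -- the equivalence, for connected `Ω`
    ((W.graph.induce Ω).Connected →
      (W.IsDpMassive p Ω ↔ ∃ Ω₁ ⊆ Ω, ¬ W.IsParabolic p Ω₁ ∧ W.capacity p Ω₁ Ω < ∞)) ∧
    -- the forward implication, for every `Ω`
    (W.IsDpMassive p Ω → ∃ Ω₁ ⊆ Ω, ¬ W.IsParabolic p Ω₁ ∧ W.capacity p Ω₁ Ω < ∞) ∧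
    -- the capacitary condition, for every `Ω`
    ((∃ Ω₁ ⊆ Ω, ¬ W.IsParabolic p Ω₁ ∧ W.capacity p Ω₁ Ω < ∞) ↔
      ∃ U ⊆ Ω, (W.graph.induce U).Connected ∧ W.IsDpMassive p U) := by
  refine ⟨fun hΩc => ⟨fun h => h.exists_not_isParabolic W hconn hp hΩ hΩ', ?_⟩,
    fun h => h.exists_not_isParabolic W hconn hp hΩ hΩ', ?_, ?_⟩
  · rintro ⟨Ω₁, hsub, hpar, hcap⟩
    obtain ⟨U, -, -, hU, hUeq⟩ := W.exists_isDpMassive hconn hp hΩ' hsub hpar hcap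
    exact hUeq hΩc ▸ hU
  · rintro ⟨Ω₁, hsub, hpar, hcap⟩
    obtain ⟨U, hUΩ, hUc, hU, -⟩ := W.exists_isDpMassive hconn hp hΩ' hsub hpar hcap
    exact ⟨U, hUΩ, hUc, hU⟩
  · rintro ⟨U, hUΩ, hUc, hU⟩
    obtain ⟨o⟩ := hUc.nonempty
    obtain ⟨Ω₁, hsub, hpar, hcap⟩ := hU.exists_not_isParabolic W hconn hp ⟨o, o.2⟩
      fun h => hΩ' (Set.eq_univ_of_univ_subset (h ▸ hUΩ))
    exact ⟨Ω₁, hsub.trans hUΩ, hpar, (W.capacity_anti p Ω₁ hUΩ).trans_lt hcap⟩
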